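/- Let $G$ be a group. For a finite symmetric (that is, inverse-closed) generating set $A$ of $G$, the geodesic language $\mathsf{Geo}(G,A)$ is the set of all words over the alphabet $A$ that label a path of minimal length between two vertices of the Cayley graph of $G$ over $A$. A language $L$ over an alphabet $A$ is piecewise excluding if there is a finite set $F\subset A^*$ such that a word $w\in A^*$ is in $L$ if and only if no element of $F$ is a piecewise subword (a not necessarily contiguous subsequence) of $w$. Theorem. The quaternion group $Q_8$ of order $8$ is, up to isomorphism, the only non-abelian $2$-generator group whose geodesic language is piecewise excluding for every finite symmetric generating set. That is, a group $G$ is isomorphic to $Q_8$ if and only if $G$ is non-abelian, $G$ can be generated by two elements, and $\mathsf{Geo}(G,A)$ is piecewise excluding for every finite symmetric generating set $A$ of $G$. -/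

import Mathlib

/-- A language `L` over an alphabet `α` is piecewise excluding if there is a finite set `F` of words
such that a word belongs to `L` if and only if it contains no piecewise subword in `F`.
(`u.Sublist w` says that `u` is a piecewise, i.e. not necessarily contiguous, subword of `w`.) -/
def IsPiecewiseExcluding {α : Type*} (L : Language α) : Prop :=
  ∃ F : Set (List α), F.Finite ∧ ∀ w : List α, w ∈ L ↔ ∀ u ∈ F, ¬ u.Sublist w

/-- `A` is a finite symmetric (inverse-closed) generating set of the group `G`. -/
structure IsFiniteSymmGenSet {G : Type*} [Group G] (A : Set G) : Prop where
  finite : A.Finite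
  symm : ∀ a ∈ A, a⁻¹ ∈ A
  closure_eq_top : Subgroup.closure A = ⊤

/-- The word `w` over the alphabet `A` labels a path from `g` to `h` in the Cayley graph of `G` over
`A`, whose edges labelled `a` run from `x` to `x * a`. -/
def LabelsPath {G : Type*} [Group G] (A : Set G) (g : G) (w : List A) (h : G) : Prop :=
  g * (w.map (fun a : A => (a : G))).prod = h

/-- The geodesic language of `G` over `A`: all words over `A` which label a path of minimal length
between two vertices of the Cayley graph. -/
def geodesicLanguage {G : Type*} [Group G] (A : Set G) : Language A :=
  {w : List A | ∃ g h : G, LabelsPath A g w h ∧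
    ∀ v : List A, LabelsPath A g v h → w.length ≤ v.length}

/-- `G` is a 2-generator group: it is generated by (at most) two elements. -/
def IsTwoGenerator (G : Type*) [Group G] : Prop :=
  ∃ a b : G, Subgroup.closure {a, b} = ⊤

/-! A piecewise excluding language is closed under piecewise subwords. Since `a a⁻¹` is never
geodesic, neither is `a b a⁻¹`, so the conjugate `a * b * a⁻¹` is a product of at most two letters.
For the alphabet `{a, a⁻¹, b, b⁻¹}` with `a`, `b` non-commuting generators, this leaves the seven
relations of `ShortConj`. Every generating pair satisfies one of them, so they can be played against
each other on pairs such as `(a⁻¹, b)`, `(a, a * b)` and `(b * a, a)`. Each combination either makes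
the generators commute or leads to a pair satisfying `x * b * x⁻¹ = b⁻¹` and `x * x = b * b`
(`exists_isQuaternionPair`), which forces `Q₈`. Conversely, a generating set of `Q₈` contains two
non-commuting letters, and these reach every element in at most two steps; diameter at most two
makes geodesics closed under subwords, and bounded length makes the excluded set finite. -/

theorem IsPiecewiseExcluding.mem_of_sublist {α : Type*} {L : Language α}
    (hL : IsPiecewiseExcluding L) {u w : List α} (hw : w ∈ L) (huw : u.Sublist w) : u ∈ L := by
  obtain ⟨F, -, hF⟩ := hL
  exact (hF u).2 fun v hv hvu => (hF w).1 hw v hv (hvu.trans huw)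

/-- A language of words of length at most `n` over a finite alphabet is piecewise excluding as soon
as it is closed under piecewise subwords. -/
theorem isPiecewiseExcluding_of_length_le {α : Type*} [Finite α] {L : Language α} (n : ℕ)
    (hlen : ∀ w ∈ L, w.length ≤ n) (hsub : ∀ u w : List α, w ∈ L → u.Sublist w → u ∈ L) :
    IsPiecewiseExcluding L := by
  -- The bound `n + 1` lets a too long word be excluded by its prefix of length `n + 1`, which lies
  -- outside `L`.
  refine ⟨{u | u.length ≤ n + 1 ∧ u ∉ L},
    (List.finite_length_le α (n + 1)).subset fun u hu => hu.1, fun w =>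
    ⟨fun hw u hu huw => hu.2 (hsub u w hw huw), fun h => ?_⟩⟩
  by_contra hw
  rcases le_total w.length (n + 1) with hl | hl
  · exact h w ⟨hl, hw⟩ (List.Sublist.refl w)
  · have hl' : (w.take (n + 1)).length = n + 1 := by simpa using hl
    refine h (w.take (n + 1)) ⟨hl'.le, fun hm => ?_⟩ (List.take_sublist _ _)
    have := hlen _ hm
    omega

/-! ### Geodesic words and diameter two -/

section Geodesic

variable {G : Type*} [Group G]

theorem mem_geodesicLanguage_iff {A : Set G} {w : List A} :
    w ∈ geodesicLanguage A ↔ ∀ v : List A,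
      (v.map (fun a : A => (a : G))).prod = (w.map (fun a : A => (a : G))).prod →
        w.length ≤ v.length := by
  constructor
  · rintro ⟨g, h, hw, hmin⟩ v hv
    exact hmin v (by rw [LabelsPath, hv]; exact hw)
  · exact fun h => ⟨1, _, rfl, fun v hv => h v (mul_left_cancel hv)⟩

/-- If every element is a product of at most two letters, then piecewise subwords of geodesics are
geodesics. -/
theorem isPiecewiseExcluding_geodesicLanguage_of_diam_le_two {A : Set G} (hA : A.Finite)
    (h : ∀ g : G, ∃ v : List A, v.length ≤ 2 ∧ (v.map (fun a : A => (a : G))).prod = g) :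
    IsPiecewiseExcluding (geodesicLanguage A) := by
  have : Finite A := hA
  have hlen : ∀ w ∈ geodesicLanguage A, w.length ≤ 2 := fun w hw => by
    obtain ⟨v, hv, hvw⟩ := h (w.map (fun a : A => (a : G))).prod
    exact (mem_geodesicLanguage_iff.1 hw v hvw).trans hv
  refine isPiecewiseExcluding_of_length_le 2 hlen fun u w hw huw => ?_
  rcases huw.length_le.eq_or_lt with heq | hlt
  · rwa [huw.eq_of_length heq]
  rw [mem_geodesicLanguage_iff] at hw ⊢
  intro v hv
  by_contra! hvu
  have hw2 := hlen w (mem_geodesicLanguage_iff.2 hw)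
  -- A proper subword that is not geodesic is a single letter equal to `1`; deleting it from `w`
  -- would shorten `w`.
  have hu1 : u.length = 1 := by omega
  have hv0 : v = [] := List.eq_nil_of_length_eq_zero (by omega)
  obtain ⟨x, rfl⟩ := List.length_eq_one_iff.1 hu1
  obtain ⟨y, z, rfl⟩ := List.length_eq_two.1 (show w.length = 2 by simp at hlt; omega)
  have hx : (x : G) = 1 := by simpa [hv0] using hv.symm
  rcases (show x = y ∨ x = z by simpa using huw) with rfl | rfl
  · simpa using hw [z] (by simp [hx])
  · simpa using hw [y] (by simp [hx])

end Geodesic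

/-! ### Generating pairs and short conjugates -/

section TwoGenerator

variable {G : Type*} [Group G]

theorem closure_pair_eq_top_of_mem {a b c d : G} (h : Subgroup.closure {a, b} = ⊤)
    (ha : a ∈ Subgroup.closure {c, d}) (hb : b ∈ Subgroup.closure {c, d}) :
    Subgroup.closure {c, d} = ⊤ := by
  rw [eq_top_iff, ← h, Subgroup.closure_le]
  rintro x (rfl | rfl)
  exacts [ha, hb]

theorem mem_closure_pair_left (a b : G) : a ∈ Subgroup.closure {a, b} :=
  Subgroup.subset_closure (by simp)

theorem mem_closure_pair_right (a b : G) : b ∈ Subgroup.closure {a, b} :=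
  Subgroup.subset_closure (by simp)

theorem closure_pair_swap {a b : G} (h : Subgroup.closure {a, b} = ⊤) :
    Subgroup.closure {b, a} = ⊤ := by rwa [Set.pair_comm]

theorem closure_inv_pair {a b : G} (h : Subgroup.closure {a, b} = ⊤) :
    Subgroup.closure {a⁻¹, b} = ⊤ :=
  closure_pair_eq_top_of_mem h (by simpa using Subgroup.inv_mem _ (mem_closure_pair_left a⁻¹ b))
    (mem_closure_pair_right _ _)

theorem closure_pair_mul {a b : G} (h : Subgroup.closure {a, b} = ⊤) :
    Subgroup.closure {a, a * b} = ⊤ := by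
  refine closure_pair_eq_top_of_mem h (mem_closure_pair_left _ _) ?_
  simpa using Subgroup.mul_mem _ (Subgroup.inv_mem _ (mem_closure_pair_left a (a * b)))
    (mem_closure_pair_right a (a * b))

theorem closure_mul_pair {a b : G} (h : Subgroup.closure {a, b} = ⊤) :
    Subgroup.closure {b * a, a} = ⊤ := by
  refine closure_pair_eq_top_of_mem h (mem_closure_pair_right _ _) ?_
  simpa using Subgroup.mul_mem _ (mem_closure_pair_left (b * a) a)
    (Subgroup.inv_mem _ (mem_closure_pair_right (b * a) a))

theorem mul_comm_of_closure_pair {a b : G} (h : Subgroup.closure {a, b} = ⊤)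
    (hab : a * b = b * a) (x y : G) : x * y = y * x := by
  have hgen : ∀ s ∈ ({a, b} : Set G), ∀ t ∈ ({a, b} : Set G), s * t = t * s := by
    rintro s (rfl | rfl) t (rfl | rfl)
    exacts [rfl, hab, hab.symm, rfl]
  have := Subgroup.isMulCommutative_closure hgen
  have hx : x ∈ Subgroup.closure {a, b} := h ▸ Subgroup.mem_top x
  have hy : y ∈ Subgroup.closure {a, b} := h ▸ Subgroup.mem_top y
  exact setLike_mul_comm hx hy

theorem isFiniteSymmGenSet_pair {a b : G} (h : Subgroup.closure {a, b} = ⊤) :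
    IsFiniteSymmGenSet ({a, a⁻¹, b, b⁻¹} : Set G) where
  finite := by simp
  symm := by rintro x (rfl | rfl | rfl | rfl) <;> simp
  closure_eq_top := by
    rw [eq_top_iff, ← h]
    exact Subgroup.closure_mono (by rintro x (rfl | rfl) <;> simp)

/-- The relations, other than those forcing `a` and `b` to commute, saying that `a * b * a⁻¹` is a
product of at most two elements of `{a, a⁻¹, b, b⁻¹}`. -/
def ShortConj (a b : G) : Prop :=
  a * b * a⁻¹ = b⁻¹ ∨ a * b * a⁻¹ = b * b ∨ a * b * a⁻¹ = b⁻¹ * b⁻¹ ∨ b * a * b⁻¹ = a * a ∨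
    b⁻¹ * a * b = a * a ∨ b * a * a * b = a ∨ b * a * b = a * a

/-- The word `a b a⁻¹` has the non-geodesic subword `a a⁻¹`, so some word of length at most two has
the same value. -/
theorem exists_conj_eq_of_isPiecewiseExcluding {A : Set G}
    (hA : IsPiecewiseExcluding (geodesicLanguage A)) {a b : G} (ha : a ∈ A) (ha' : a⁻¹ ∈ A)
    (hb : b ∈ A) :
    a * b * a⁻¹ = 1 ∨ a * b * a⁻¹ ∈ A ∨ ∃ x ∈ A, ∃ y ∈ A, a * b * a⁻¹ = x * y := by
  have hn : ([⟨a, ha⟩, ⟨b, hb⟩, ⟨a⁻¹, ha'⟩] : List A) ∉ geodesicLanguage A := fun hg => by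
    have := mem_geodesicLanguage_iff.1
      (hA.mem_of_sublist hg (u := [⟨a, ha⟩, ⟨a⁻¹, ha'⟩]) (by simp)) [] (by simp)
    simp at this
  rw [mem_geodesicLanguage_iff] at hn
  push Not at hn
  obtain ⟨v, hv, hlen⟩ := hn
  match v, hv, hlen with
  | [], hv, _ => exact Or.inl (by simpa [mul_assoc] using hv.symm)
  | [x], hv, _ =>
    have : (x : G) = a * b * a⁻¹ := by simpa [mul_assoc] using hv
    exact Or.inr (Or.inl (this ▸ x.2))
  | [x, y], hv, _ =>
    exact Or.inr (Or.inr ⟨x, x.2, y, y.2, by simpa [mul_assoc] using hv.symm⟩)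
  | _ :: _ :: _ :: _, _, hlen => simp at hlen; omega

theorem shortConj_of_isPiecewiseExcluding {a b : G}
    (hA : IsPiecewiseExcluding (geodesicLanguage ({a, a⁻¹, b, b⁻¹} : Set G)))
    (hab : a * b ≠ b * a) : ShortConj a b := by
  unfold ShortConj
  -- Neither generator is a power of the other; this rules out most of the short values of the
  -- conjugate.
  have hpow : ∀ n : ℤ, b ≠ a ^ n := by
    rintro n rfl
    exact hab ((Commute.refl a).zpow_right n)
  have hpow' : ∀ n : ℤ, a ≠ b ^ n := by
    rintro n rfl
    exact hab ((Commute.refl b).zpow_left n)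
  rcases exists_conj_eq_of_isPiecewiseExcluding hA (a := a) (b := b) (by simp) (by simp)
    (by simp) with h | h | ⟨x, hx, y, hy, h⟩
  · exact absurd (conj_eq_one_iff.1 h) (by simpa using hpow 0)
  · rcases h with h | h | h | h
    · exact absurd (mul_left_cancel (mul_inv_eq_iff_eq_mul.1 h)) (by simpa using hpow 1)
    · exact absurd (eq_inv_of_mul_eq_one_right (by simpa using mul_inv_eq_iff_eq_mul.1 h))
        (by simpa using hpow (-1))
    · exact absurd (mul_inv_eq_iff_eq_mul.1 h) hab
    · exact Or.inl h
  · have h1 : ¬ a * b * a⁻¹ = 1 := fun h => hpow 0 (by simpa using h)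
    have ha1 : a ≠ 1 := by simpa using hpow' 0
    have h2 := mul_inv_eq_iff_eq_mul.1 h
    rcases hx with hx | hx | hx | hx <;> rcases hy with hy | hy | hy | hy <;> rw [hx, hy] at h h2
    · exact absurd (mul_left_cancel (h2.trans (mul_assoc _ _ _)))
        (by simpa [zpow_ofNat, pow_two] using hpow 2)
    · exact absurd (h.trans (mul_inv_cancel _)) h1
    · exact absurd (by simpa using h) ha1
    · have : b * b = a := by
        have := mul_left_cancel (h2.trans (mul_assoc _ _ _))
        rw [eq_inv_mul_iff_mul_eq] at this
        exact this
      exact absurd this.symm (by simpa [zpow_ofNat, pow_two] using hpow' 2)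
    · exact absurd (h.trans (inv_mul_cancel _)) h1
    · have : a * (a * b) = 1 := by rw [h2]; group
      rw [← mul_assoc] at this
      exact absurd (eq_inv_of_mul_eq_one_right this) (by simpa [zpow_neg, zpow_ofNat, pow_two] using hpow (-2))
    · have : b * a * b⁻¹ = a * a := by
        rw [mul_inv_eq_iff_eq_mul, mul_assoc, h2]; group
      simp [this]
    · have : b * a * a * b = a := by
        calc b * a * a * b = b * a * (a * b) := by group
          _ = a := by rw [h2]; group
      simp [this]
    · have : b⁻¹ * a * b = a * a := by
        rw [mul_assoc, h2]; group
      simp [this]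
    · exact absurd (by simpa using h2) ha1
    · simp [h]
    · exact absurd (h.trans (mul_inv_cancel _)) h1
    · have : b * a * b = a * a := by
        rw [mul_assoc, h2]; group
      simp [this]
    · exact absurd (show a = b⁻¹ * b⁻¹ by rw [eq_mul_inv_iff_mul_eq, h2]; group)
        (by simpa [zpow_neg, zpow_ofNat, pow_two] using hpow' (-2))
    · exact absurd (h.trans (inv_mul_cancel _)) h1
    · simp [h]

end TwoGenerator

/-! ### The quaternion group -/

section Quaternion

variable {G : Type*} [Group G]

open QuaternionGroup

/-- The relations define a surjection from `Q₈`. A nontrivial kernel would give `b * b = 1`, hence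
`b = b⁻¹`, or make `x` a power of `b`; either way `x` and `b` commute. -/
theorem nonempty_mulEquiv_quaternionGroup_two {x b : G} (hgen : Subgroup.closure {x, b} = ⊤)
    (hne : x * b ≠ b * x) (hconj : x * b * x⁻¹ = b⁻¹) (hsq : x * x = b * b) :
    Nonempty (G ≃* QuaternionGroup 2) := by
  have hb4 : b ^ (2 * 2) = 1 := by
    -- Conjugation by `x` inverts `b * b`, but fixes it because it equals `x * x`.
    have : b * b = b⁻¹ * b⁻¹ := by
      calc b * b = x * (x * x) * x⁻¹ := by rw [← hsq]; group
        _ = (x * b * x⁻¹) * (x * b * x⁻¹) := by rw [hsq]; group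
        _ = _ := by rw [hconj]
    calc b ^ (2 * 2) = b * b * (b * b) := by rw [pow_mul, pow_two, pow_two]
      _ = 1 := by nth_rw 1 [this]; group
  let f : ZMod (2 * 2) → G := fun i => b ^ i.val
  have hadd : ∀ i j, f (i + j) = f i * f j := fun i j => by
    simp only [f, ZMod.val_add, ← pow_add]
    exact (pow_eq_pow_mod _ hb4).symm
  have h0 : f 0 = 1 := by simp [f]
  have h2 : f 2 = x * x := by rw [hsq]; exact pow_two b
  have h1 : f 1 = b := pow_one b
  have hneg : ∀ i, f (-i) = (f i)⁻¹ := fun i =>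
    eq_inv_of_mul_eq_one_left (by rw [← hadd, neg_add_cancel, h0])
  have hx : ∀ i, f i * x = x * (f i)⁻¹ := fun i => by
    have : x * f i * x⁻¹ = (f i)⁻¹ := by simp only [f]; rw [← conj_pow, hconj, inv_pow]
    have := congrArg (·⁻¹) this
    simp only [mul_inv_rev, inv_inv] at this
    calc f i * x = x * ((f i)⁻¹ * x⁻¹) * x := by rw [this]
      _ = _ := by group
  let F : QuaternionGroup 2 →* G := MonoidHom.mk' (fun | a i => f i | xa i => x * f i) <| by
    rintro (i | i) (j | j)
    · exact hadd i j
    · change x * f (j - i) = f i * (x * f j)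
      rw [← mul_assoc, hx, sub_eq_neg_add, hadd, hneg, mul_assoc]
    · change x * f (i + j) = x * f i * f j
      rw [hadd, mul_assoc]
    · change f (2 + j - i) = x * f i * (x * f j)
      calc f (2 + j - i) = x * x * (f i)⁻¹ * f j := by
            rw [add_sub_assoc, sub_eq_neg_add, hadd, hadd, h2, hneg, mul_assoc (x * x)]
        _ = x * (f i * x) * f j := by rw [hx]; group
        _ = _ := by group
  have hFa : ∀ i, F (a i) = f i := fun _ => rfl
  have hFx : ∀ i, F (xa i) = x * f i := fun _ => rfl
  have hsurj : Function.Surjective F := by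
    rw [← MonoidHom.range_eq_top, eq_top_iff, ← hgen, Subgroup.closure_le]
    rintro y (rfl | rfl)
    · exact ⟨xa 0, by rw [hFx, h0, mul_one]⟩
    · exact ⟨a 1, by rw [hFa, h1]⟩
  have hcomm : ∀ i, f i * b = b * f i := fun i => ((Commute.refl b).pow_left _)
  have hinj : Function.Injective F := by
    rw [injective_iff_map_eq_one]
    rintro (i | i) hi
    · rw [hFa] at hi
      have hbb : b * b ≠ 1 := fun h => hne <| by
        rw [mul_inv_eq_iff_eq_mul, ← eq_inv_of_mul_eq_one_left h] at hconj
        exact hconj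
      have hb1 : b ≠ 1 := by rintro rfl; simp at hbb
      have : i = 0 ∨ i = 1 ∨ i = 2 ∨ i = -1 := by clear hi; revert i; decide
      rcases this with rfl | rfl | rfl | rfl
      · rfl
      · exact absurd (h1.symm.trans hi) hb1
      · exact absurd (hsq.symm.trans (h2.symm.trans hi)) hbb
      · rw [hneg, h1, inv_eq_one] at hi
        exact absurd hi hb1
    · rw [hFx] at hi
      have := hcomm i
      rw [eq_inv_of_mul_eq_one_left hi] at hne
      exact absurd ((Commute.inv_left (hcomm i))) hne
  exact ⟨(MulEquiv.ofBijective F ⟨hinj, hsurj⟩).symm⟩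

/-- Non-commuting elements behave like `i` and `j`: the list is `±1, ±x, ±y, ±xy`, with `x * x = -1`
and `y * x = -(x * y)`. -/
theorem quaternionGroup_two_eq_short_product : ∀ x y : QuaternionGroup 2, x * y ≠ y * x →
    ∀ g : QuaternionGroup 2, g = 1 ∨ g = x ∨ g = x⁻¹ ∨ g = y ∨ g = y⁻¹ ∨ g = x * x ∨ g = x * y ∨
      g = y * x := by
  decide

theorem isPiecewiseExcluding_of_mulEquiv_quaternionGroup_two (e : G ≃* QuaternionGroup 2)
    {A : Set G} (hA : IsFiniteSymmGenSet A) : IsPiecewiseExcluding (geodesicLanguage A) := by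
  obtain ⟨x, hx, y, hy, hxy⟩ : ∃ x ∈ A, ∃ y ∈ A, x * y ≠ y * x := by
    by_contra! hcomm
    have := Subgroup.isMulCommutative_closure hcomm
    have hmem : ∀ g, e.symm g ∈ Subgroup.closure A := fun g =>
      hA.closure_eq_top ▸ Subgroup.mem_top _
    have := setLike_mul_comm (hmem (a 1)) (hmem (xa 0))
    rw [← map_mul, ← map_mul, e.symm.injective.eq_iff] at this
    revert this
    decide
  refine isPiecewiseExcluding_geodesicLanguage_of_diam_le_two hA.finite fun g => ?_
  have := quaternionGroup_two_eq_short_product (e x) (e y)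
    (by rwa [← map_mul, ← map_mul, e.injective.ne_iff]) (e g)
  simp only [← map_mul, ← map_inv, e.injective.eq_iff, map_eq_one_iff e e.injective] at this
  rcases this with rfl | rfl | rfl | rfl | rfl | rfl | rfl | rfl
  · exact ⟨[], by simp⟩
  · exact ⟨[⟨_, hx⟩], by simp⟩
  · exact ⟨[⟨_, hA.symm _ hx⟩], by simp⟩
  · exact ⟨[⟨_, hy⟩], by simp⟩
  · exact ⟨[⟨_, hA.symm _ hy⟩], by simp⟩
  · exact ⟨[⟨_, hx⟩, ⟨_, hx⟩], by simp⟩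
  · exact ⟨[⟨_, hx⟩, ⟨_, hy⟩], by simp⟩
  · exact ⟨[⟨_, hy⟩, ⟨_, hx⟩], by simp⟩

end Quaternion

/-! ### Playing the short conjugate relations against each other -/

section Classification

variable {G : Type*} [Group G]

/-- `x` and `b` generate `G`, do not commute, and satisfy the defining relations of the quaternion
group of order `8`. -/
def IsQuaternionPair (x b : G) : Prop :=
  Subgroup.closure {x, b} = ⊤ ∧ x * b ≠ b * x ∧ x * b * x⁻¹ = b⁻¹ ∧ x * x = b * b

/-- Any two generators `a`, `b` of `G` do not commute and satisfy `ShortConj a b`. -/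
def GeneratingPairsShortConj (G : Type*) [Group G] : Prop :=
  ∀ a b : G, Subgroup.closure {a, b} = ⊤ → a * b ≠ b * a ∧ ShortConj a b

/-- On the pair `(a, a * b)`, inversion of `a * b` by `a` yields `a * a = b * b`; the other six
relations make `a` and `b` commute. -/
theorem exists_isQuaternionPair_of_conj_eq_inv (hG : GeneratingPairsShortConj G) {a b : G}
    (hgen : Subgroup.closure {a, b} = ⊤)
    (h : a * b * a⁻¹ = b⁻¹) : ∃ x y : G, IsQuaternionPair x y := by
  have hne := (hG a b hgen).1
  -- `r1` to `r4` are rewriting rules that move `a` to the left of powers of `b`.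
  have r1 : b⁻¹ * a = a * b := (mul_inv_eq_iff_eq_mul.1 h).symm
  have r2 : b * a = a * b⁻¹ := by rw [eq_mul_inv_iff_mul_eq, mul_assoc, ← r1, mul_inv_cancel_left]
  have r3 : ∀ z, b * (a * z) = a * (b⁻¹ * z) := fun z => by rw [← mul_assoc, r2, mul_assoc]
  have r4 : ∀ z, b⁻¹ * (a * z) = a * (b * z) := fun z => by rw [← mul_assoc, r1, mul_assoc]
  have hk := (hG a (a * b) (closure_pair_mul hgen)).2
  unfold ShortConj at hk
  rcases hk with hk | hk | hk | hk | hk | hk | hk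
  · refine ⟨a, b, hgen, hne, h, ?_⟩
    have : a * (a * (b * b)) = 1 := by
      calc a * (a * (b * b)) = a * (a * (b * (a⁻¹ * (a * b)))) := by simp
        _ = a * (a * b) * a⁻¹ * (a * b) := by simp only [mul_assoc]
        _ = 1 := by rw [hk, inv_mul_cancel]
    have haa : a * a = b⁻¹ * b⁻¹ := by
      rw [← mul_inv_rev, eq_inv_iff_mul_eq_one, mul_assoc, this]
    calc a * a = a * (a * a) * a⁻¹ := by simp [mul_assoc]
      _ = (a * b * a⁻¹)⁻¹ * (a * b * a⁻¹)⁻¹ := by rw [haa]; simp [mul_assoc]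
      _ = b * b := by rw [h, inv_inv]
  all_goals refine absurd ?_ hne
  · rw [mul_inv_eq_iff_eq_mul] at hk
    have : b = a := by simpa [mul_assoc, r1, r2, r3, r4] using hk
    rw [this]
  · have : a * (a * b) * a⁻¹ * (a * b) * (a * b) = 1 := by rw [hk]; simp [mul_assoc]
    have : a * (a * a) * b⁻¹ = 1 := by simpa [mul_assoc, r1, r2, r3, r4] using this
    rw [← mul_inv_eq_one.1 this]
    simp [mul_assoc]
  · have : a * b * a = a * a * (a * b) := by rw [← hk]; simp [mul_assoc]
    have : b⁻¹ = a * b := by simpa [mul_assoc, r1, r2, r3, r4] using this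
    simp [eq_mul_inv_iff_mul_eq.2 this.symm, mul_assoc]
  · have : b * b = a := by
      simpa [mul_assoc, r1, r2, r3, r4, eq_comm] using hk
    simp [← this, mul_assoc]
  · have h3 : a * (a * a) = 1 := by simpa [mul_assoc, r1, r2, r3, r4] using hk
    have h2 : Commute (a * a) b := by
      simp [Commute, SemiconjBy, mul_assoc, r1, r3]
    rw [eq_inv_of_mul_eq_one_left h3]
    exact h2.inv_left
  · have h3 : a * (b * b) = 1 := by simpa [mul_assoc, r1, r2, r3, r4] using hk
    rw [eq_inv_of_mul_eq_one_left h3]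
    simp [mul_assoc]

/-- On `(a, a * b)` only inversion is compatible with non-commuting generators, and that case is
already settled. -/
theorem exists_isQuaternionPair_of_conj_eq_mul_self_of_pow_five (hG : GeneratingPairsShortConj G) {a b : G}
    (hgen : Subgroup.closure {a, b} = ⊤) (h : a * b * a⁻¹ = b * b)
    (h5 : b * (b * (b * (b * b))) = 1) : ∃ x y : G, IsQuaternionPair x y := by
  have hne := (hG a b hgen).1
  have r1 : a * b = b * (b * a) := by
    rw [mul_inv_eq_iff_eq_mul.1 h, mul_assoc]
  have r2 : ∀ z, a * (b * z) = b * (b * (a * z)) := fun z => by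
    rw [← mul_assoc, r1, mul_assoc, mul_assoc]
  have r3 : ∀ z, b * (b * (b * (b * (b * z)))) = z := fun z => by
    calc _ = b * (b * (b * (b * b))) * z := by simp only [mul_assoc]
      _ = z := by rw [h5, one_mul]
  have hk := (hG a (a * b) (closure_pair_mul hgen)).2
  unfold ShortConj at hk
  rcases hk with hk | hk | hk | hk | hk | hk | hk
  · exact exists_isQuaternionPair_of_conj_eq_inv hG (closure_pair_mul hgen) hk
  all_goals refine absurd ?_ hne
  · have : a = b * (b * (a * a)) := by
      simpa [mul_inv_eq_iff_eq_mul, mul_assoc, r1, r2] using hk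
    have : b * b * a = 1 := by
      rw [← mul_right_cancel_iff (a := a)]; simpa [mul_assoc] using this.symm
    rw [eq_inv_of_mul_eq_one_right this]
    simp [mul_assoc]
  · have : a * (a * b) * a⁻¹ * (a * b) * (a * b) = 1 := by rw [hk]; simp [mul_assoc]
    have : b * (a * (a * a)) = 1 := by simpa [mul_assoc, r1, r2, r3] using this
    rw [eq_inv_of_mul_eq_one_left this]
    simp [mul_assoc]
  · have : a * b * a = a * a * (a * b) := by rw [← hk]; simp [mul_assoc]
    simp only [mul_assoc, r1, r2, r3] at this
    have : b * a = 1 := by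
      rw [← mul_left_inj (a * a)]; simpa [mul_assoc] using this.symm
    rw [eq_inv_of_mul_eq_one_left this]
    simp
  · have : a * (a * b) = a * b * (a * a) := by rw [← hk]; simp [mul_assoc]
    simp only [mul_assoc, r1, r2, mul_right_inj] at this
    have : b * b = a := by
      rw [← mul_left_inj (a * a)]; simpa [mul_assoc] using this
    simp [← this, mul_assoc]
  · simp only [mul_assoc, r1, r2, r3] at hk
    have h3 : b * (b * b) = (a * (a * a))⁻¹ := by
      rw [eq_inv_iff_mul_eq_one, ← mul_left_inj a]; simpa [mul_assoc] using hk
    have hb : b * a = b * (b * (b * a)) := by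
      calc b * a = a * (b * (b * b)) := by simp only [r1, r2, r3]
        _ = b * (b * b) * a := by rw [h3]; simp [mul_assoc]
        _ = _ := by simp only [mul_assoc]
    have hbb : b * b = 1 := by
      rw [← mul_left_inj a, ← mul_right_inj b]; simpa [mul_assoc] using hb.symm
    have hb1 : b = 1 := by simpa [hbb] using h5
    simp [hb1]
  · simp only [mul_assoc, r1, r2, r3] at hk
    have : a = 1 := by simpa using hk
    simp [this]

/-- Compare with `(a⁻¹, b)`: if `a⁻¹` also squares `b`, then `b = b⁴`, so `b² = b⁻¹`; if it sends
`b` to `b⁻²`, then `b⁵ = 1`. -/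
theorem exists_isQuaternionPair_of_conj_eq_mul_self (hG : GeneratingPairsShortConj G) {a b : G}
    (hgen : Subgroup.closure {a, b} = ⊤) (h : a * b * a⁻¹ = b * b) :
    ∃ x y : G, IsQuaternionPair x y := by
  have hne := (hG a b hgen).1
  have hab : a * b = b * (b * a) := by rw [mul_inv_eq_iff_eq_mul.1 h, mul_assoc]
  have hab' : ∀ z, a * (b * z) = b * (b * (a * z)) := fun z => by
    rw [← mul_assoc, hab, mul_assoc, mul_assoc]
  have hk := (hG a⁻¹ b (closure_inv_pair hgen)).2
  unfold ShortConj at hk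
  rcases hk with hk | hk | hk | hk | hk | hk | hk
  · exact exists_isQuaternionPair_of_conj_eq_inv hG (closure_inv_pair hgen) hk
  · refine exists_isQuaternionPair_of_conj_eq_inv hG hgen ?_
    have : b = b * b * (b * b) := by
      calc b = a * (a⁻¹ * b * a⁻¹⁻¹) * a⁻¹ := by simp [mul_assoc]
        _ = (a * b * a⁻¹) * (a * b * a⁻¹) := by rw [hk]; simp [mul_assoc]
        _ = _ := by rw [h]
    have : b * (b * b) = 1 := by simpa [mul_assoc] using this
    rw [h, eq_inv_of_mul_eq_one_right this]
  · refine exists_isQuaternionPair_of_conj_eq_mul_self_of_pow_five hG hgen h ?_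
    have : b = (b * b)⁻¹ * (b * b)⁻¹ := by
      calc b = a * (a⁻¹ * b * a⁻¹⁻¹) * a⁻¹ := by simp [mul_assoc]
        _ = (a * b * a⁻¹)⁻¹ * (a * b * a⁻¹)⁻¹ := by rw [hk]; simp [mul_assoc]
        _ = _ := by rw [h]
    rw [← mul_inv_rev, eq_inv_iff_mul_eq_one] at this
    simpa [mul_assoc] using this
  all_goals refine absurd ?_ hne
  · have : b * a = b * (b * (b * (b * (a * a)))) := by
      calc b * a = (b * a⁻¹ * b⁻¹)⁻¹ * b := by simp [mul_assoc]
        _ = a * (a * b) := by rw [hk]; simp [mul_assoc]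
        _ = _ := by simp only [hab, hab']
    have : b * b * b * a = 1 := by
      rw [← mul_right_cancel_iff (a := a)]; simpa [mul_assoc] using this.symm
    rw [eq_inv_of_mul_eq_one_right this]
    simp [mul_assoc]
  · have : b * (b * a) = b * (a * a) := by
      calc b * (b * a) = b * (b⁻¹ * a⁻¹ * b)⁻¹ := by rw [← hab]; simp [mul_assoc]
        _ = _ := by rw [hk]; simp
    have : b = a := by simpa using this
    rw [this]
  · have : b * (b * (b * a)) = a * a := by
      calc b * (b * (b * a)) = b * (b * a⁻¹ * a⁻¹ * b)⁻¹ * b := by rw [hk]; simp [hab, mul_assoc]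
        _ = _ := by simp [mul_assoc]
    have : b * (b * b) = a := by
      rw [← mul_right_cancel_iff (a := a)]; simpa [mul_assoc] using this
    simp [← this, mul_assoc]
  · have : b = b⁻¹ * b⁻¹ * a⁻¹ := by
      calc b = a * b⁻¹ * (b * a⁻¹ * b) := by simp [mul_assoc]
        _ = (a * b * a⁻¹)⁻¹ * a⁻¹ := by rw [hk]; simp [mul_assoc]
        _ = _ := by rw [h]; simp
    have : b * (b * b) = a⁻¹ := by
      nth_rw 3 [this]; simp [mul_assoc]
    rw [← inv_inv a, ← this]
    simp [mul_assoc]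

/-- On `(a⁻¹, b)`, inversion and squaring are settled; `b⁻²` again would give `b³ = 1`, so `a` would
fix `b`. -/
theorem exists_isQuaternionPair_of_conj_eq_inv_mul_inv (hG : GeneratingPairsShortConj G) {a b : G}
    (hgen : Subgroup.closure {a, b} = ⊤) (h : a * b * a⁻¹ = b⁻¹ * b⁻¹) :
    ∃ x y : G, IsQuaternionPair x y := by
  have hne := (hG a b hgen).1
  have h' : a * b⁻¹ * a⁻¹ = b * b := by
    calc a * b⁻¹ * a⁻¹ = (a * b * a⁻¹)⁻¹ := by simp [mul_assoc]
      _ = _ := by rw [h]; simp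
  have r1 : a * b⁻¹ = b * (b * a) := by rw [mul_inv_eq_iff_eq_mul.1 h', mul_assoc]
  have r2 : ∀ z, a * (b⁻¹ * z) = b * (b * (a * z)) := fun z => by
    rw [← mul_assoc, r1, mul_assoc, mul_assoc]
  have hk := (hG a⁻¹ b (closure_inv_pair hgen)).2
  unfold ShortConj at hk
  rcases hk with hk | hk | hk | hk | hk | hk | hk
  · exact exists_isQuaternionPair_of_conj_eq_inv hG (closure_inv_pair hgen) hk
  · exact exists_isQuaternionPair_of_conj_eq_mul_self hG (closure_inv_pair hgen) hk
  all_goals refine absurd ?_ hne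
  · have : b = b * b * (b * b) := by
      calc b = a * (a⁻¹ * b * a⁻¹⁻¹) * a⁻¹ := by simp [mul_assoc]
        _ = (a * b⁻¹ * a⁻¹) * (a * b⁻¹ * a⁻¹) := by rw [hk]; simp [mul_assoc]
        _ = _ := by rw [h']
    have : b * b * b = 1 := by simpa [mul_assoc] using this
    rw [mul_inv_eq_iff_eq_mul.1 h, ← mul_inv_rev, ← eq_inv_of_mul_eq_one_right this]
  · have : b * (b * (b * a)) = a * a := by
      calc b * (b * (b * a)) = (b * a⁻¹ * b⁻¹)⁻¹ := by rw [← r1]; simp [mul_assoc]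
        _ = _ := by rw [hk]; simp
    have : b * (b * b) = a := by
      rw [← mul_left_inj a]; simpa [mul_assoc] using this
    simp [← this, mul_assoc]
  · have : a * b = b * (a * a) := by
      calc a * b = b * (b⁻¹ * a⁻¹ * b)⁻¹ := by simp [mul_assoc]
        _ = _ := by rw [hk]; simp
    rw [mul_inv_eq_iff_eq_mul.1 h, ← mul_assoc b, mul_left_inj] at this
    rw [← inv_mul_eq_iff_eq_mul.2 this]
    simp [mul_assoc]
  · have : a * (b * (b * a)) = b * a := by
      calc a * (b * (b * a)) = b * (b * a⁻¹ * a⁻¹ * b)⁻¹ := by rw [← r1]; simp [mul_assoc]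
        _ = _ := by rw [hk, inv_inv]
    have : a * b = 1 := by
      rw [← mul_left_inj (b * a)]; simpa [mul_assoc] using this
    rw [eq_inv_of_mul_eq_one_left this]
    simp
  · have : b * a = a * a := by
      calc b * a = (b * a⁻¹ * b)⁻¹ := by simp [mul_assoc, r1]
        _ = _ := by rw [hk]; simp
    rw [mul_right_cancel this]

/-- The relation gives `(b * a)² = a³`, so on `(b * a, a)` the two relations of `ShortConj` that are
not conjugations collapse to `b = a⁴` or `b = 1`. -/
theorem exists_isQuaternionPair_of_mul_mul_eq (hG : GeneratingPairsShortConj G) {a b : G}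
    (hgen : Subgroup.closure {a, b} = ⊤) (h : b * a * b = a * a) :
    ∃ x y : G, IsQuaternionPair x y := by
  have hne := (hG a b hgen).1
  have hgen' := closure_mul_pair hgen
  have hsq : (b * a) * (b * a) = a * a * a := by rw [← h]; simp only [mul_assoc]
  have hk := (hG (b * a) a hgen').2
  unfold ShortConj at hk
  rcases hk with hk | hk | hk | hk | hk | hk | hk
  · exact exists_isQuaternionPair_of_conj_eq_inv hG hgen' hk
  · exact exists_isQuaternionPair_of_conj_eq_mul_self hG hgen' hk
  · exact exists_isQuaternionPair_of_conj_eq_inv_mul_inv hG hgen' hk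
  · exact exists_isQuaternionPair_of_conj_eq_mul_self hG (closure_pair_swap hgen') hk
  · exact exists_isQuaternionPair_of_conj_eq_mul_self hG
      (closure_inv_pair (closure_pair_swap hgen')) (by rwa [inv_inv])
  · rw [mul_assoc a, hsq, ← mul_assoc, mul_left_inj] at hk
    refine absurd ?_ hne
    simp [← hk, mul_assoc]
  · rw [hsq] at hk
    have : b = 1 := by simpa using mul_left_cancel (mul_right_cancel hk)
    exact absurd (by simp [this]) hne

theorem exists_isQuaternionPair (hG : GeneratingPairsShortConj G) {a b : G}
    (hgen : Subgroup.closure {a, b} = ⊤) :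
    ∃ x y : G, IsQuaternionPair x y := by
  have key : ∀ a b : G, Subgroup.closure {a, b} = ⊤ →
      (∃ x y : G, IsQuaternionPair x y) ∨ b * a * a * b = a := by
    intro a b hgen
    rcases (hG a b hgen).2 with hk | hk | hk | hk | hk | hk | hk
    · exact Or.inl (exists_isQuaternionPair_of_conj_eq_inv hG hgen hk)
    · exact Or.inl (exists_isQuaternionPair_of_conj_eq_mul_self hG hgen hk)
    · exact Or.inl (exists_isQuaternionPair_of_conj_eq_inv_mul_inv hG hgen hk)
    · exact Or.inl (exists_isQuaternionPair_of_conj_eq_mul_self hG (closure_pair_swap hgen) hk)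
    · exact Or.inl (exists_isQuaternionPair_of_conj_eq_mul_self hG
        (closure_inv_pair (closure_pair_swap hgen)) (by rwa [inv_inv]))
    · exact Or.inr hk
    · exact Or.inl (exists_isQuaternionPair_of_mul_mul_eq hG hgen hk)
  -- Inverting the leftover relation for `(a⁻¹, b)` turns it into `b * a * b = a * a`, already
  -- settled.
  refine (key a⁻¹ b (closure_inv_pair hgen)).elim id fun h => ?_
  refine exists_isQuaternionPair_of_mul_mul_eq hG hgen ?_
  calc b * a * b = b * (b * a⁻¹ * a⁻¹ * b)⁻¹ * b := by rw [h, inv_inv]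
    _ = a * a := by simp [mul_assoc]

end Classification

theorem mainTheorem1 (G : Type*) [Group G] :
    ((¬ ∀ x y : G, x * y = y * x) ∧ IsTwoGenerator G ∧
        ∀ A : Set G, IsFiniteSymmGenSet A → IsPiecewiseExcluding (geodesicLanguage A)) ↔
      Nonempty (G ≃* QuaternionGroup 2) := by
  constructor
  · rintro ⟨hne, ⟨a, b, hab⟩, hA⟩
    obtain ⟨x, y, hgen, hxy, hconj, hsq⟩ := exists_isQuaternionPair (fun a b hgen => by
      have hcomm : a * b ≠ b * a := fun h => hne (mul_comm_of_closure_pair hgen h)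
      exact ⟨hcomm, shortConj_of_isPiecewiseExcluding (hA _ (isFiniteSymmGenSet_pair hgen)) hcomm⟩)
      hab
    exact nonempty_mulEquiv_quaternionGroup_two hgen hxy hconj hsq
  · rintro ⟨e⟩
    refine ⟨fun h => ?_, ⟨e.symm (.a 1), e.symm (.xa 0), ?_⟩,
      fun A hA => isPiecewiseExcluding_of_mulEquiv_quaternionGroup_two e hA⟩
    · have := h (e.symm (.a 1)) (e.symm (.xa 0))
      rw [← map_mul, ← map_mul, e.symm.injective.eq_iff] at this
      revert this
      decide
    · rw [eq_top_iff]
      rintro g -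
      set x : G := e.symm (.a 1) with hx
      set y : G := e.symm (.xa 0) with hy
      have h1 := mem_closure_pair_left x y
      have h2 := mem_closure_pair_right x y
      have := quaternionGroup_two_eq_short_product (e x) (e y)
        (by rw [hx, hy, e.apply_symm_apply, e.apply_symm_apply]; decide) (e g)
      simp only [← map_mul, ← map_inv, e.injective.eq_iff, map_eq_one_iff e e.injective] at this
      rcases this with h | h | h | h | h | h | h | h <;> rw [h]
      exacts [one_mem _, h1, inv_mem h1, h2, inv_mem h2, mul_mem h1 h1, mul_mem h1 h2,
        mul_mem h2 h1]
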